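/- Let $\mathfrak g$ be a finite-dimensional real Lie algebra and let $\operatorname{Aut}(\mathfrak g)$ be its group of Lie algebra automorphisms, with the Lie group structure induced from $GL(\mathfrak g)\subset\operatorname{End}(\mathfrak g)$. Let $\operatorname{Int}(\mathfrak g)\subseteq\operatorname{Aut}(\mathfrak g)$ be the normal subgroup generated by the automorphisms $\exp(\operatorname{ad}u)$, $u\in\mathfrak g$; let $q:\operatorname{Aut}(\mathfrak g)\to\operatorname{Aut}(\mathfrak g)/\operatorname{Int}(\mathfrak g)$ be the quotient map and put $\operatorname{ad}\mathfrak g=\{\operatorname{ad}u : u\in\mathfrak g\}\subseteq\operatorname{End}(\mathfrak g)$. Let $\operatorname{Aut}(\mathfrak g)^{\delta}$ denote the group $\operatorname{Aut}(\mathfrak g)$ with the coarsest topology that refines its usual topology and for which the quotient topology on $\operatorname{Aut}(\mathfrak g)/\operatorname{Int}(\mathfrak g)$ is discrete. Let $M$ be a (finite-dimensional) smooth manifold without boundary and let $\varphi:M\to\operatorname{Aut}(\mathfrak g)$ be a smooth map. For $x\in M$ and $X\in T_xM$ let $\frac{\partial\varphi}{\partial X}\in\operatorname{End}(\mathfrak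 g)$ be the derivative of $\varphi$ at $x$ in the direction $X$, where $\varphi$ is regarded as a map into the vector space $\operatorname{End}(\mathfrak g)$. Then the following are equivalent: 1. $q\circ\varphi:M\to\operatorname{Aut}(\mathfrak g)/\operatorname{Int}(\mathfrak g)$ is locally constant; 2. $\frac{\partial\varphi}{\partial X}\,\varphi(x)^{-1}\in\operatorname{ad}\mathfrak g$ for every $x\in M$ and every $X\in T_xM$; 3. $\varphi:M\to\operatorname{Aut}(\mathfrak g)^{\delta}$ is continuous. -/

import Mathlib

open scoped Manifold ContDiff Topology

noncomputable section

/-! ### The normed algebra of endomorphisms of a finite-dimensional real vector space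

All norms on a finite-dimensional space are equivalent, so the choice made here affects neither the
topology nor the smooth structure. -/

/-- `End(V)` as a normed ring: the operator norm for the sup norm in some basis of `V`. -/
instance endNormedRing (V : Type*) [AddCommGroup V] [Module ℝ V] [FiniteDimensional ℝ V] :
    NormedRing (Module.End ℝ V) :=
  letI : NormedRing (Matrix (Fin (Module.finrank ℝ V)) (Fin (Module.finrank ℝ V)) ℝ) :=
    Matrix.linftyOpNormedRing
  NormedRing.induced _ _ (LinearMap.toMatrixAlgEquiv (Module.finBasis ℝ V))
    (LinearMap.toMatrixAlgEquiv (Module.finBasis ℝ V)).injective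

/-- `End(V)` as a real normed algebra. -/
instance endNormedAlgebra (V : Type*) [AddCommGroup V] [Module ℝ V] [FiniteDimensional ℝ V] :
    NormedAlgebra ℝ (Module.End ℝ V) :=
  letI : NormedRing (Matrix (Fin (Module.finrank ℝ V)) (Fin (Module.finrank ℝ V)) ℝ) :=
    Matrix.linftyOpNormedRing
  letI : NormedAlgebra ℝ (Matrix (Fin (Module.finrank ℝ V)) (Fin (Module.finrank ℝ V)) ℝ) :=
    Matrix.linftyOpNormedAlgebra
  NormedAlgebra.induced ℝ _ _ (LinearMap.toMatrixAlgEquiv (Module.finBasis ℝ V))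

instance endCompleteSpace (V : Type*) [AddCommGroup V] [Module ℝ V] [FiniteDimensional ℝ V] :
    CompleteSpace (Module.End ℝ V) :=
  FiniteDimensional.complete ℝ _

/-! ### The group of automorphisms of a Lie algebra -/

/-- The automorphisms of a real Lie algebra. -/
abbrev LieAut (g : Type*) [LieRing g] [LieAlgebra ℝ g] : Type _ := g ≃ₗ⁅ℝ⁆ g

namespace LieAut

section Algebra

variable {g : Type*} [LieRing g] [LieAlgebra ℝ g]

/-- `LieAut g` is a group under composition: `(a * b) x = a (b x)`. -/
instance instGroup : Group (LieAut g) where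
  mul a b := b.trans a
  one := 1
  inv a := a.symm
  mul_assoc _ _ _ := rfl
  one_mul _ := rfl
  mul_one _ := rfl
  inv_mul_cancel a := by
    refine LieEquiv.ext (fun x => ?_)
    exact a.symm_apply_apply x

/-- The inclusion of `Aut(g)` into `End(g)`. -/
def toEnd (a : LieAut g) : Module.End ℝ g := (a.toLinearEquiv : g →ₗ[ℝ] g)

@[simp] theorem toEnd_apply (a : LieAut g) (x : g) : a.toEnd x = a x := rfl

theorem mul_apply (a b : LieAut g) (x : g) : (a * b) x = a (b x) := rfl

theorem toEnd_one : (1 : LieAut g).toEnd = 1 := rfl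

theorem toEnd_mul (a b : LieAut g) : (a * b).toEnd = a.toEnd * b.toEnd := rfl

theorem toEnd_injective : Function.Injective (toEnd (g := g)) := fun _ _ h =>
  LieEquiv.ext (fun x => LinearMap.congr_fun h x)

/-- The map `y ↦ ⁅x, y⁆`. -/
def bracketLeft (x : g) : Module.End ℝ g where
  toFun y := ⁅x, y⁆
  map_add' _ _ := lie_add _ _ _
  map_smul' _ _ := lie_smul _ _ _

@[simp] theorem bracketLeft_apply (x y : g) : bracketLeft x y = ⁅x, y⁆ := rfl

end Algebra

variable {g : Type*} [LieRing g] [LieAlgebra ℝ g] [FiniteDimensional ℝ g]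

/-- The topology of `Aut(g)`, as a subspace of `End(g)`; since `GL(g)` is open in `End(g)`, it is
also the subspace topology from `GL(g)`. -/
instance instTopologicalSpace : TopologicalSpace (LieAut g) :=
  TopologicalSpace.induced toEnd inferInstance

theorem exp_mul_exp_neg (A : Module.End ℝ g) : NormedSpace.exp A * NormedSpace.exp (-A) = 1 := by
  let : NormedAlgebra ℚ (Module.End ℝ g) := NormedAlgebra.restrictScalars ℚ ℝ _
  rw [← NormedSpace.exp_add_of_commute (Commute.neg_right (Commute.refl A)), add_neg_cancel,
    NormedSpace.exp_zero]

/-- The exponential of a derivation respects the bracket. -/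
theorem exp_derivation_lie (D : LieDerivation ℝ g g) (x y : g) :
    NormedSpace.exp (D : Module.End ℝ g) ⁅x, y⁆ =
      ⁅NormedSpace.exp (D : Module.End ℝ g) x, NormedSpace.exp (D : Module.End ℝ g) y⁆ := by
  set A : Module.End ℝ g := (D : Module.End ℝ g) with hA
  let L : Module.End ℝ g →ₗ[ℝ] Module.End ℝ g :=
    { toFun := fun B => bracketLeft (B x)
      map_add' := fun B C => by ext z; simp
      map_smul' := fun c B => by ext z; simp }
  have hD : ∀ z : g, bracketLeft (A z) = A * bracketLeft z - bracketLeft z * A := by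
    intro z
    ext w
    simp [hA]
  let F : ℝ → Module.End ℝ g := fun t =>
    NormedSpace.exp (t • (-A)) * (L (NormedSpace.exp (t • A)) * NormedSpace.exp (t • A))
  have hF : ∀ t, HasDerivAt F 0 t := by
    intro t
    have h1 := hasDerivAt_exp_smul_const (𝕂 := ℝ) (-A) t
    have h2 := hasDerivAt_exp_smul_const' (𝕂 := ℝ) A t
    have h3 : HasDerivAt (fun u : ℝ => L (NormedSpace.exp (u • A)))
        (L (A * NormedSpace.exp (t • A))) t :=
      (LinearMap.toContinuousLinearMap L).hasFDerivAt.comp_hasDerivAt t h2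
    have h4 := h1.mul (h3.mul h2)
    have hL : L (A * NormedSpace.exp (t • A)) =
        A * L (NormedSpace.exp (t • A)) - L (NormedSpace.exp (t • A)) * A :=
      hD (NormedSpace.exp (t • A) x)
    refine h4.congr_deriv ?_
    rw [hL, Pi.mul_apply]
    noncomm_ring
  have hc : F 1 = F 0 := by
    have hdiff : Differentiable ℝ F := fun t => (hF t).differentiableAt
    exact is_const_of_deriv_eq_zero hdiff (fun t => (hF t).deriv) 1 0
  have hc' : NormedSpace.exp (-A) * (L (NormedSpace.exp A) * NormedSpace.exp A) =
      bracketLeft x := by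
    simpa [F, L] using hc
  have hc'' : L (NormedSpace.exp A) * NormedSpace.exp A =
      NormedSpace.exp A * bracketLeft x := by
    rw [← hc', ← mul_assoc, exp_mul_exp_neg, one_mul]
  exact (LinearMap.congr_fun hc'' y).symm

/-- The exponential map `Der(g) → Aut(g)`. -/
def exp (D : LieDerivation ℝ g g) : LieAut g where
  toFun x := NormedSpace.exp (D : Module.End ℝ g) x
  invFun x := NormedSpace.exp (-(D : Module.End ℝ g)) x
  map_add' := map_add _
  map_smul' := map_smul _
  map_lie' := exp_derivation_lie D _ _
  left_inv x := by
    have h := exp_mul_exp_neg (-(D : Module.End ℝ g))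
    rw [neg_neg] at h
    exact LinearMap.congr_fun h x
  right_inv x := LinearMap.congr_fun (exp_mul_exp_neg (D : Module.End ℝ g)) x

theorem toEnd_exp (D : LieDerivation ℝ g g) :
    (exp D).toEnd = NormedSpace.exp (D : Module.End ℝ g) := rfl

variable (g) in
/-- `Int(g)`: the subgroup of `Aut(g)` generated by the automorphisms `exp (ad u)`. -/
def inner : Subgroup (LieAut g) :=
  Subgroup.closure (Set.range fun u : g => exp (LieDerivation.ad ℝ g u))

theorem conj_exp_ad (a : LieAut g) (u : g) :
    a * exp (LieDerivation.ad ℝ g u) * a⁻¹ = exp (LieDerivation.ad ℝ g (a u)) := by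
  let : NormedAlgebra ℚ (Module.End ℝ g) := NormedAlgebra.restrictScalars ℚ ℝ _
  apply toEnd_injective
  let y : (Module.End ℝ g)ˣ :=
    { val := a.toEnd
      inv := a⁻¹.toEnd
      val_inv := by rw [← toEnd_mul, mul_inv_cancel, toEnd_one]
      inv_val := by rw [← toEnd_mul, inv_mul_cancel, toEnd_one] }
  rw [toEnd_mul, toEnd_mul, toEnd_exp, toEnd_exp]
  refine (NormedSpace.exp_units_conj y _).symm.trans (congrArg _ ?_)
  ext z
  have h1 : ((LieDerivation.ad ℝ g (a u) : LieDerivation ℝ g g) : Module.End ℝ g) z = ⁅a u, z⁆ := by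
    simp
  have h2 : ((LieDerivation.ad ℝ g u : LieDerivation ℝ g g) : Module.End ℝ g) (a.symm z) =
      ⁅u, a.symm z⁆ := by
    simp
  refine Eq.trans ?_ h1.symm
  refine (congrArg a h2).trans ?_
  rw [LieEquiv.map_lie, LieEquiv.apply_symm_apply]

instance inner_normal : (inner g).Normal := by
  have h : inner g = Subgroup.normalClosure
      (Set.range fun u : g => exp (LieDerivation.ad ℝ g u)) := by
    apply le_antisymm Subgroup.closure_le_normalClosure
    refine (Subgroup.closure_le _).2 fun b hb => ?_
    obtain ⟨_, ⟨u, rfl⟩, hu⟩ := Group.mem_conjugatesOfSet_iff.1 hb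
    obtain ⟨a, rfl⟩ := isConj_iff.1 hu
    rw [conj_exp_ad]
    exact Subgroup.subset_closure ⟨a u, rfl⟩
  rw [h]
  infer_instance

variable (g) in
/-- `ad(g)`: the subspace of `End(g)` of all maps `ad u : y ↦ ⁅u, y⁆`, for `u` in `g`. -/
def adRange : Submodule ℝ (Module.End ℝ g) :=
  letI : LieRing (Module.End ℝ g) := LieRing.ofAssociativeRing
  LinearMap.range (LieAlgebra.ad ℝ g : g →ₗ[ℝ] Module.End ℝ g)

variable (g) in
/-- The quotient homomorphism `q : Aut(g) → Aut(g)/Int(g)`. -/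
def q : LieAut g →* LieAut g ⧸ inner g := QuotientGroup.mk' (inner g)

variable (g) in
/-- The topology of `Aut(g)^δ`: generated by the usual open sets of `Aut(g)` and the preimages under
`q` of all subsets of `Aut(g)/Int(g)`. -/
@[reducible] def deltaTopology : TopologicalSpace (LieAut g) :=
  instTopologicalSpace ⊓ TopologicalSpace.induced (q g) ⊥

/-- `deltaTopology` is the coarsest topology that refines the usual one and for which the quotient
topology on `Aut(g)/Int(g)` is discrete (in the order on topologies, `≤` means finer). -/
theorem isGreatest_deltaTopology :
    IsGreatest {t : TopologicalSpace (LieAut g) |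
      t ≤ instTopologicalSpace ∧ TopologicalSpace.coinduced (q g) t = ⊥} (deltaTopology g) := by
  refine ⟨⟨inf_le_left, ?_⟩, fun t ht => le_inf ht.1 ?_⟩
  · rw [eq_bot_iff, ← continuous_iff_coinduced_le]
    exact continuous_inf_dom_right continuous_induced_dom
  · rw [← coinduced_le_iff_le_induced]
    exact ht.2.le

section Smooth

variable {E : Type*} [NormedAddCommGroup E] [NormedSpace ℝ E]
  {H : Type*} [TopologicalSpace H] (I : ModelWithCorners ℝ E H)
  {M : Type*} [TopologicalSpace M] [ChartedSpace H M]

/-- Smoothness of `φ : M → Aut(g)`. The group `Aut(g)` carries the smooth structure of a closed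
(hence embedded) subgroup of `GL(g)`, which is open in the vector space `End(g)`; so a map into
`Aut(g)` is smooth exactly if it is smooth as a map into `End(g)`. -/
def IsSmooth (φ : M → LieAut g) : Prop :=
  ContMDiff I 𝓘(ℝ, Module.End ℝ g) ∞ (fun y => (φ y).toEnd)

/-- The derivative `∂φ/∂X ∈ End(g)` of `φ : M → Aut(g) ⊆ End(g)` in the direction of a tangent
vector `X` at `x`. -/
def dirDeriv (φ : M → LieAut g) (x : M) (X : TangentSpace I x) : Module.End ℝ g :=
  mfderiv I 𝓘(ℝ, Module.End ℝ g) (fun y => (φ y).toEnd) x X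

end Smooth

end LieAut

end

/-! Conditions 1 and 3 are equivalent formally: a map into `Aut(g)^δ` is continuous iff it is
continuous for the usual topology, which smoothness gives, and its composite with `q` is locally
constant.

For 1 ⇔ 2, put `h = ad g` and consider the distribution on units of `End(g)` whose space at `a` is
`h * a`. As `h` is stable under conjugation by `exp h`, Duhamel's formula shows that `exp` on `h` is
tangent to this distribution. So the coordinates `exp X * (1 + Y)`, with `X` in `h` and `Y` in a
complement, straighten it near 1, and a short tangent path from 1 keeps `Y = 0` (`exists_log`).
Applied to `φ * φ(x)⁻¹` along segments in a chart, this gives 2 ⇒ 1.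

For 1 ⇒ 2 the difficulty is that `Int(g)` need not be closed. It is, however, a countable union of
compact sets of products of `n` exponentials of elements of norm at most `R`. By Baire, a curve in
`Int(g)` stays locally in one such set at a dense set of times; there compactness makes it tangent
to the distribution (`deriv_mem`), and continuity of the derivative carries this to every time. -/

namespace ExpFoliation

variable {𝔸 : Type*} [NormedRing 𝔸] [NormedAlgebra ℝ 𝔸]

/-! ### The exponential of a Banach algebra and its derivative -/

section Complete

variable [CompleteSpace 𝔸]

theorem exp_continuous : Continuous (NormedSpace.exp : 𝔸 → 𝔸) := by
  let : NormedAlgebra ℚ 𝔸 := NormedAlgebra.restrictScalars ℚ ℝ _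
  exact NormedSpace.exp_continuous

theorem exp_contDiff {n : WithTop ℕ∞} : ContDiff ℝ n (NormedSpace.exp : 𝔸 → 𝔸) := by
  refine contDiff_iff_contDiffAt.2 fun x => ?_
  exact (NormedSpace.exp_analytic (𝕂 := ℝ) x).contDiffAt

theorem exp_mul_exp_neg (A : 𝔸) : NormedSpace.exp A * NormedSpace.exp (-A) = 1 := by
  let : NormedAlgebra ℚ 𝔸 := NormedAlgebra.restrictScalars ℚ ℝ _
  rw [← NormedSpace.exp_add_of_commute (Commute.neg_right (Commute.refl A)), add_neg_cancel,
    NormedSpace.exp_zero]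

theorem exp_neg_mul_exp (A : 𝔸) : NormedSpace.exp (-A) * NormedSpace.exp A = 1 := by
  simpa using exp_mul_exp_neg (-A)

/-- Duhamel's formula for a difference of exponentials. -/
theorem exp_add_mul_exp_neg_sub_one (X Z : 𝔸) (ε : ℝ) :
    NormedSpace.exp (X + ε • Z) * NormedSpace.exp (-X) - 1 =
      ε • ∫ s in (0 : ℝ)..1,
        NormedSpace.exp (s • (X + ε • Z)) * Z * NormedSpace.exp (s • (-X)) := by
  have hd : ∀ s : ℝ, HasDerivAt
      (fun s : ℝ => NormedSpace.exp (s • (X + ε • Z)) * NormedSpace.exp (s • (-X)))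
      (ε • (NormedSpace.exp (s • (X + ε • Z)) * Z * NormedSpace.exp (s • (-X)))) s := by
    intro s
    -- The two derivatives are taken with their new factors facing each other, so `X` cancels and
    -- only `ε • Z` remains in the middle.
    have h1 := hasDerivAt_exp_smul_const (𝕂 := ℝ) (X + ε • Z) s
    have h2 := hasDerivAt_exp_smul_const' (𝕂 := ℝ) (-X) s
    refine (h1.mul h2).congr_deriv ?_
    simp only [mul_add, add_mul, mul_smul_comm, smul_mul_assoc, neg_mul, mul_neg, mul_assoc]
    abel
  have hc : Continuous fun s : ℝ =>
      ε • (NormedSpace.exp (s • (X + ε • Z)) * Z * NormedSpace.exp (s • (-X))) := by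
    have := exp_continuous (𝔸 := 𝔸)
    fun_prop
  rw [← intervalIntegral.integral_smul,
    intervalIntegral.integral_eq_sub_of_hasDerivAt (fun s _ => hd s) (hc.intervalIntegrable _ _)]
  simp

/-- The derivative of the exponential map. -/
theorem fderiv_exp_mul_exp_neg (X Z : 𝔸) :
    fderiv ℝ NormedSpace.exp X Z * NormedSpace.exp (-X) =
      ∫ s in (0 : ℝ)..1, NormedSpace.exp (s • X) * Z * NormedSpace.exp (s • (-X)) := by
  have hexp := exp_continuous (𝔸 := 𝔸)
  have h1 : HasDerivAt (fun ε : ℝ => NormedSpace.exp (X + ε • Z) * NormedSpace.exp (-X))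
      (fderiv ℝ NormedSpace.exp X Z * NormedSpace.exp (-X)) 0 := by
    have hl : HasDerivAt (fun ε : ℝ => X + ε • Z) Z 0 := by
      simpa using ((hasDerivAt_id (0 : ℝ)).smul_const Z).const_add X
    have he : HasFDerivAt NormedSpace.exp (fderiv ℝ NormedSpace.exp X) (X + (0 : ℝ) • Z) := by
      simpa using ((exp_contDiff (n := 1)).differentiable one_ne_zero X).hasFDerivAt
    exact (he.comp_hasDerivAt (0 : ℝ) hl).mul_const _
  have hK : Continuous fun ε : ℝ => ∫ s in (0 : ℝ)..1,
      NormedSpace.exp (s • (X + ε • Z)) * Z * NormedSpace.exp (s • (-X)) := by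
    apply intervalIntegral.continuous_parametric_intervalIntegral_of_continuous'
    unfold Function.uncurry
    fun_prop
  -- By Duhamel's formula the difference quotient is exactly the integral with parameter `ε`, so its
  -- limit is the value at `ε = 0`.
  have h2 : HasDerivAt (fun ε : ℝ => NormedSpace.exp (X + ε • Z) * NormedSpace.exp (-X))
      (∫ s in (0 : ℝ)..1, NormedSpace.exp (s • X) * Z * NormedSpace.exp (s • (-X))) 0 := by
    rw [hasDerivAt_iff_tendsto_slope_zero]
    have hlim := hK.tendsto 0
    simp only [zero_smul, add_zero] at hlim
    refine (hlim.mono_left nhdsWithin_le_nhds).congr' ?_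
    filter_upwards [self_mem_nhdsWithin] with ε hε
    rw [zero_add, zero_smul, add_zero, exp_mul_exp_neg, exp_add_mul_exp_neg_sub_one, smul_smul,
      inv_mul_cancel₀ hε, one_smul]
  exact h1.unique h2

end Complete

/-! ### Stable subspaces and coordinates adapted to them -/

variable [FiniteDimensional ℝ 𝔸]

/-- A subspace is stable under conjugation by the exponentials of its elements. -/
def IsExpStable (h : Submodule ℝ 𝔸) : Prop :=
  ∀ X ∈ h, ∀ Z ∈ h, NormedSpace.exp X * Z * NormedSpace.exp (-X) ∈ h

/-- Transversality of `h` and `k` survives a small perturbation. Projecting to `k` along `h` kills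
`C`, so `w` is the projection of `C * Y`; hence `‖C‖ ≤ (‖π‖ + 1) * ‖Y‖ * ‖C‖`, and the choice of `r`
makes the factor less than 1/2. -/
theorem eq_zero_of_eq_mul_one_add {h k : Submodule ℝ 𝔸} (hk : IsCompl h k) :
    ∃ r > 0, ∀ Y : 𝔸, ‖Y‖ < r → ∀ C ∈ h, ∀ w ∈ k, w = C * (1 + Y) → w = 0 := by
  let π : 𝔸 →L[ℝ] k := LinearMap.toContinuousLinearMap (k.projectionOnto h hk.symm)
  have hπh : ∀ z ∈ h, π z = 0 := fun z hz =>
    (Submodule.projectionOnto_apply_eq_zero_iff hk.symm).2 hz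
  have hπk : ∀ z : k, π z = z := fun z => Submodule.projectionOnto_apply_left hk.symm z
  refine ⟨1 / (2 * (‖π‖ + 1)), by positivity, fun Y hY C hC w hw hwC => ?_⟩
  have hn : 0 ≤ ‖π‖ := norm_nonneg π
  rw [lt_div_iff₀ (by positivity)] at hY
  have e1 : w = C + C * Y := by rw [hwC, mul_add, mul_one]
  have e2 : (⟨w, hw⟩ : k) = π (C * Y) := by
    rw [← hπk ⟨w, hw⟩]
    simp only [e1, map_add, hπh C hC, zero_add]
  have n1 : ‖w‖ ≤ ‖π‖ * (‖C‖ * ‖Y‖) := by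
    calc ‖w‖ = ‖(⟨w, hw⟩ : k)‖ := rfl
      _ = ‖π (C * Y)‖ := by rw [e2]
      _ ≤ ‖π‖ * ‖C * Y‖ := π.le_opNorm _
      _ ≤ _ := by gcongr; exact norm_mul_le _ _
  have n2 : ‖C‖ ≤ ‖w‖ + ‖C‖ * ‖Y‖ := by
    calc ‖C‖ = ‖w - C * Y‖ := by rw [e1]; simp
      _ ≤ ‖w‖ + ‖C * Y‖ := norm_sub_le _ _
      _ ≤ _ := by gcongr; exact norm_mul_le _ _
  have hY0 := norm_nonneg Y
  have hC0 := norm_nonneg C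
  have hw0 := norm_nonneg w
  have n3 : ‖C‖ * (1 - (‖π‖ + 1) * ‖Y‖) ≤ 0 := by nlinarith
  have n4 : ‖C‖ = 0 := by
    apply le_antisymm _ hC0
    by_contra! hpos
    nlinarith
  rw [hwC, norm_eq_zero.1 n4, zero_mul]

variable {h : Submodule ℝ 𝔸} [CompleteSpace 𝔸]

/-- The integrand of the derivative formula consists of conjugates of `Z` by `exp (s • X)`, all in
`h`; a projection with kernel `h` commutes with the integral. -/
theorem IsExpStable.fderiv_exp_mem (hh : IsExpStable h) {X Z : 𝔸} (hX : X ∈ h) (hZ : Z ∈ h) :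
    fderiv ℝ NormedSpace.exp X Z * NormedSpace.exp (-X) ∈ h := by
  rw [fderiv_exp_mul_exp_neg]
  obtain ⟨k, hk⟩ := h.exists_isCompl
  have hexp := exp_continuous (𝔸 := 𝔸)
  let π : 𝔸 →L[ℝ] k := LinearMap.toContinuousLinearMap (k.projectionOnto h hk.symm)
  have hπ : ∀ z, π z = 0 ↔ z ∈ h := fun z => Submodule.projectionOnto_apply_eq_zero_iff hk.symm
  rw [← hπ, ← ContinuousLinearMap.intervalIntegral_comp_comm]
  · have : ∀ s : ℝ, π (NormedSpace.exp (s • X) * Z * NormedSpace.exp (s • (-X))) = 0 := by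
      intro s
      rw [hπ, smul_neg]
      exact hh _ (h.smul_mem s hX) _ hZ
    simp only [this, intervalIntegral.integral_zero]
  · apply Continuous.intervalIntegrable
    fun_prop

/-- Near the identity the leaves of the foliation spanned by `h` are the exponentials of small
elements of `h` translated by a transversal `1 + Y`. -/
theorem exists_chart {h k : Submodule ℝ 𝔸} (hk : IsCompl h k) :
    ∃ σ : 𝔸 → h × k, ContDiffAt ℝ 1 σ 1 ∧ σ 1 = 0 ∧
      ∀ᶠ z in 𝓝 (1 : 𝔸), NormedSpace.exp ((σ z).1 : 𝔸) * (1 + ((σ z).2 : 𝔸)) = z := by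
  let Ψ : h × k → 𝔸 := fun p => NormedSpace.exp (p.1 : 𝔸) * (1 + (p.2 : 𝔸))
  let e : (h × k) ≃L[ℝ] 𝔸 := (Submodule.prodEquivOfIsCompl h k hk).toContinuousLinearEquiv
  have h0 : Ψ 0 = 1 := by simp [Ψ]
  have hi1 : ContDiff ℝ 1 fun p : h × k => (p.1 : 𝔸) :=
    h.subtypeL.contDiff.comp contDiff_fst
  have hi2 : ContDiff ℝ 1 fun p : h × k => (p.2 : 𝔸) :=
    k.subtypeL.contDiff.comp contDiff_snd
  have hΨ : ContDiff ℝ 1 Ψ := (exp_contDiff.comp hi1).mul (contDiff_const.add hi2)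
  -- At the origin the derivative is `(X, Y) ↦ X + Y`, invertible since `h` and `k` are
  -- complementary, so the inverse function theorem applies.
  have hΨ' : HasFDerivAt Ψ (e : (h × k) →L[ℝ] 𝔸) 0 := by
    have d1 : HasFDerivAt (fun p : h × k => NormedSpace.exp (p.1 : 𝔸))
        ((1 : 𝔸 →L[ℝ] 𝔸).comp (h.subtypeL.comp (ContinuousLinearMap.fst ℝ h k))) 0 :=
      HasFDerivAt.comp (0 : h × k) (f := fun p : h × k => (p.1 : 𝔸)) (g := NormedSpace.exp)
        (hasFDerivAt_exp_zero (𝕂 := ℝ))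
        (h.subtypeL.comp (ContinuousLinearMap.fst ℝ h k)).hasFDerivAt
    have d2 : HasFDerivAt (fun p : h × k => 1 + (p.2 : 𝔸))
        (k.subtypeL.comp (ContinuousLinearMap.snd ℝ h k)) 0 :=
      (k.subtypeL.comp (ContinuousLinearMap.snd ℝ h k)).hasFDerivAt.const_add 1
    refine (d1.mul' d2).congr_fderiv ?_
    ext p <;> simp [e]
  have hΨa : ContDiffAt ℝ 1 Ψ 0 := hΨ.contDiffAt
  refine ⟨hΨa.localInverse hΨ' one_ne_zero, ?_, ?_, ?_⟩
  · rw [← h0]; exact hΨa.to_localInverse hΨ' one_ne_zero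
  · rw [← h0]; exact hΨa.localInverse_apply_image hΨ' one_ne_zero
  · have hr := (hΨa.hasStrictFDerivAt' hΨ' one_ne_zero).eventually_right_inverse
    rw [h0] at hr
    exact hr

end ExpFoliation

/-! ### Products of exponentials and curves tangent to the foliation -/

namespace ExpFoliation

variable {𝔸 : Type*} [NormedRing 𝔸] [NormedAlgebra ℝ 𝔸]
  {h : Submodule ℝ 𝔸} [CompleteSpace 𝔸]

/-- The product `exp (u 0) * ⋯ * exp (u (n - 1))`. -/
noncomputable def prodExp : ℕ → (ℕ → h) → 𝔸
  | 0, _ => 1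
  | n + 1, u => NormedSpace.exp (u 0 : 𝔸) * prodExp n fun i => u (i + 1)

/-- The inverse of `prodExp`. -/
noncomputable def prodExpInv : ℕ → (ℕ → h) → 𝔸
  | 0, _ => 1
  | n + 1, u => prodExpInv n (fun i => u (i + 1)) * NormedSpace.exp (-(u 0 : 𝔸))

theorem prodExp_mul_prodExpInv (n : ℕ) (u : ℕ → h) : prodExp n u * prodExpInv n u = 1 := by
  induction n generalizing u with
  | zero => simp [prodExp, prodExpInv]
  | succ n ih =>
    rw [prodExp, prodExpInv, mul_assoc, ← mul_assoc (prodExp n _), ih, one_mul, exp_mul_exp_neg]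

theorem prodExpInv_mul_prodExp (n : ℕ) (u : ℕ → h) : prodExpInv n u * prodExp n u = 1 := by
  induction n generalizing u with
  | zero => simp [prodExp, prodExpInv]
  | succ n ih =>
    rw [prodExp, prodExpInv, mul_assoc, ← mul_assoc (NormedSpace.exp _), exp_neg_mul_exp, one_mul,
      ih]

theorem ringInverse_prodExp (n : ℕ) (u : ℕ → h) :
    Ring.inverse (prodExp n u) = prodExpInv n u :=
  Ring.inverse_unit
    (⟨_, _, prodExp_mul_prodExpInv n u, prodExpInv_mul_prodExp n u⟩ : 𝔸ˣ)

theorem continuous_prodExp (n : ℕ) : Continuous (prodExp n : (ℕ → h) → 𝔸) := by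
  induction n with
  | zero => exact continuous_const
  | succ n ih =>
    have := exp_continuous (𝔸 := 𝔸)
    change Continuous fun u : ℕ → h => NormedSpace.exp (u 0 : 𝔸) * prodExp n fun i => u (i + 1)
    fun_prop

variable [FiniteDimensional ℝ 𝔸]

theorem isCompact_image_prodExp (n : ℕ) (R : ℝ) :
    IsCompact (prodExp n '' Set.univ.pi fun _ : ℕ => Metric.closedBall (0 : h) R) :=
  (isCompact_univ_pi fun _ => isCompact_closedBall 0 R).image (continuous_prodExp n)

/-- A short path starting at the identity and tangent to the right translates of `h` ends at the
exponential of an element of `h`, which is given by a differentiable function `σ`. -/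
theorem IsExpStable.exists_log (hh : IsExpStable h) :
    ∃ σ : 𝔸 → h, DifferentiableAt ℝ σ 1 ∧ σ 1 = 0 ∧ ∃ W ∈ 𝓝 (1 : 𝔸), ∀ a : ℝ → 𝔸,
      (∀ t ∈ Set.Icc (0 : ℝ) 1, a t ∈ W) → a 0 = 1 →
      (∀ t ∈ Set.Icc (0 : ℝ) 1, ∃ A ∈ h, HasDerivAt a (A * a t) t) →
      NormedSpace.exp (σ (a 1) : 𝔸) = a 1 := by
  obtain ⟨k, hk⟩ := h.exists_isCompl
  obtain ⟨σ, hσ, hσ1, hright⟩ := exists_chart hk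
  obtain ⟨r, hr, hzero⟩ := eq_zero_of_eq_mul_one_add hk
  have hdiff : ∀ᶠ z in 𝓝 (1 : 𝔸), DifferentiableAt ℝ σ z :=
    (hσ.eventually (by simp)).mono fun z hz => hz.differentiableAt one_ne_zero
  have hsmall : ∀ᶠ z in 𝓝 (1 : 𝔸), ‖(σ z).2‖ < r := by
    have : ContinuousAt (fun z => ‖(σ z).2‖) 1 := hσ.continuousAt.snd.norm
    apply this.eventually_lt_const
    simpa [hσ1] using hr
  refine ⟨fun z => (σ z).1, (hσ.differentiableAt one_ne_zero).fst, by simp [hσ1], _,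
    hright.eventually_nhds.and (hdiff.and hsmall), fun a haW ha0 ha => ?_⟩
  -- Differentiating `a = exp X * (1 + Y)` and using `a' = A * a` gives `Y' = C * (1 + Y)` with `C`
  -- a conjugate of `A - B`, hence in `h`. Since `Y'` lies in `k`, it vanishes.
  have hderiv : ∀ t ∈ Set.Icc (0 : ℝ) 1, HasDerivAt (fun s => (σ (a s)).2) 0 t := by
    intro t ht
    obtain ⟨hev, hdz, hs⟩ := haW t ht
    obtain ⟨A, hA, hat⟩ := ha t ht
    have hc : HasDerivAt (fun s => σ (a s)) (fderiv ℝ σ (a t) (A * a t)) t :=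
      hdz.hasFDerivAt.comp_hasDerivAt t hat
    set p := fderiv ℝ σ (a t) (A * a t)
    have hX : HasDerivAt (fun s => (σ (a s)).1) p.1 t :=
      (ContinuousLinearMap.fst ℝ h k).hasFDerivAt.comp_hasDerivAt t hc
    have hY : HasDerivAt (fun s => (σ (a s)).2) p.2 t :=
      (ContinuousLinearMap.snd ℝ h k).hasFDerivAt.comp_hasDerivAt t hc
    have hX' : HasDerivAt (fun s => ((σ (a s)).1 : 𝔸)) p.1 t :=
      h.subtypeL.hasFDerivAt.comp_hasDerivAt t hX
    have hY' : HasDerivAt (fun s => ((σ (a s)).2 : 𝔸)) p.2 t :=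
      k.subtypeL.hasFDerivAt.comp_hasDerivAt t hY
    set X : 𝔸 := ((σ (a t)).1 : 𝔸) with hXdef
    set Y : 𝔸 := ((σ (a t)).2 : 𝔸) with hYdef
    have hE : HasDerivAt (fun s => NormedSpace.exp ((σ (a s)).1 : 𝔸))
        (fderiv ℝ NormedSpace.exp X p.1) t :=
      ((exp_contDiff (n := 1)).differentiable one_ne_zero X).hasFDerivAt.comp_hasDerivAt t hX'
    have hprod := hE.mul (hY'.const_add 1)
    have heq : (fun s => NormedSpace.exp ((σ (a s)).1 : 𝔸)) * (fun s => 1 + ((σ (a s)).2 : 𝔸))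
        =ᶠ[𝓝 t] a := hat.continuousAt.eventually hev
    have huniq := (hprod.congr_of_eventuallyEq heq.symm).unique hat
    have hat' : NormedSpace.exp X * (1 + Y) = a t := hev.self_of_nhds
    set B := fderiv ℝ NormedSpace.exp X p.1 * NormedSpace.exp (-X) with hB
    have hBh : B ∈ h := hh.fderiv_exp_mem (σ (a t)).1.2 p.1.2
    have hBX : fderiv ℝ NormedSpace.exp X p.1 = B * NormedSpace.exp X := by
      rw [hB, mul_assoc, exp_neg_mul_exp, mul_one]
    have hC : NormedSpace.exp (-X) * (A - B) * NormedSpace.exp X ∈ h := by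
      have := hh (-X) (h.neg_mem (σ (a t)).1.2) _ (h.sub_mem hA hBh)
      rwa [neg_neg] at this
    have hw : (p.2 : 𝔸) = NormedSpace.exp (-X) * (A - B) * NormedSpace.exp X * (1 + Y) := by
      have h1 : NormedSpace.exp X * (p.2 : 𝔸) = (A - B) * (NormedSpace.exp X * (1 + Y)) := by
        rw [hat', sub_mul, ← huniq, ← hat', ← mul_assoc B, ← hBX]
        simp only [← hXdef, ← hYdef, hat']
        noncomm_ring
      calc (p.2 : 𝔸) = NormedSpace.exp (-X) * (NormedSpace.exp X * p.2) := by
            rw [← mul_assoc, exp_neg_mul_exp, one_mul]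
        _ = _ := by rw [h1]; simp only [mul_assoc]
    have hp : p.2 = 0 := Subtype.ext (hzero Y hs _ hC _ p.2.2 hw)
    rwa [hp] at hY
  have hconst := constant_of_has_deriv_right_zero (f := fun s => (σ (a s)).2) (a := 0) (b := 1)
    (fun t ht => (hderiv t ht).continuousAt.continuousWithinAt)
    (fun t ht => (hderiv t (Set.Ico_subset_Icc_self ht)).hasDerivWithinAt) 1 (by simp)
  obtain ⟨hev, -, -⟩ := haW 1 (by simp)
  have h1 := hev.self_of_nhds
  rw [show (σ (a 1)).2 = 0 by simpa [ha0, hσ1] using hconst] at h1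
  simpa using h1

/-- Moving the parameters along a line gives a path to which `exists_log` applies after right
translation. By the product rule, the logarithmic derivative is that of the first factor plus the
conjugate by `exp X` of that of the tail. -/
theorem IsExpStable.exists_hasDerivAt_prodExp (hh : IsExpStable h) (n : ℕ) (u v : ℕ → h) (t : ℝ) :
    ∃ A ∈ h, HasDerivAt (fun s : ℝ => prodExp n (u + s • v)) (A * prodExp n (u + t • v)) t := by
  induction n generalizing u v with
  | zero => exact ⟨0, h.zero_mem, by simpa [prodExp] using hasDerivAt_const t (1 : 𝔸)⟩
  | succ n ih =>
    obtain ⟨A, hA, hd⟩ := ih (fun i => u (i + 1)) (fun i => v (i + 1))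
    set X : 𝔸 := (u 0 : 𝔸) + t • (v 0 : 𝔸) with hX
    have hXh : X ∈ h := h.add_mem (u 0).2 (h.smul_mem t (v 0).2)
    have hl : HasDerivAt (fun s : ℝ => (u 0 : 𝔸) + s • (v 0 : 𝔸)) (v 0 : 𝔸) t := by
      simpa using ((hasDerivAt_id t).smul_const (v 0 : 𝔸)).const_add (u 0 : 𝔸)
    have hE : HasDerivAt (fun s : ℝ => NormedSpace.exp ((u 0 : 𝔸) + s • (v 0 : 𝔸)))
        (fderiv ℝ NormedSpace.exp X (v 0)) t :=
      ((exp_contDiff (n := 1)).differentiable one_ne_zero X).hasFDerivAt.comp_hasDerivAt t hl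
    refine ⟨fderiv ℝ NormedSpace.exp X (v 0) * NormedSpace.exp (-X) +
      NormedSpace.exp X * A * NormedSpace.exp (-X),
      h.add_mem (hh.fderiv_exp_mem hXh (v 0).2) (hh X hXh A hA), (hE.mul hd).congr_deriv ?_⟩
    change _ = _ * (NormedSpace.exp X *
      prodExp n ((fun i => u (i + 1)) + t • fun i => v (i + 1)))
    rw [← mul_assoc _ (NormedSpace.exp X), add_mul, mul_assoc _ (NormedSpace.exp (-X)),
      mul_assoc _ (NormedSpace.exp (-X)), exp_neg_mul_exp, mul_one, mul_one, add_mul, ← hX,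
      mul_assoc (NormedSpace.exp X)]

/-- A curve contained in the set of products of `n` exponentials of bounded elements of `h` is
tangent to the right translates of `h`. -/
theorem IsExpStable.deriv_mem (hh : IsExpStable h) {n : ℕ} {R : ℝ} {d : ℝ → 𝔸} {d' : 𝔸} {t : ℝ}
    (hd : HasDerivAt d d' t)
    (hmem : ∀ᶠ s in 𝓝 t, d s ∈ prodExp n '' Set.univ.pi fun _ => Metric.closedBall (0 : h) R) :
    d' * Ring.inverse (d t) ∈ h := by
  obtain ⟨σ, hσ, hσ1, W, hW, hlog⟩ := hh.exists_log
  choose! U hU hdU using fun s (hs : d s ∈ prodExp n '' Set.univ.pi fun _ =>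
    Metric.closedBall (0 : h) R) => hs
  -- The parameters `U s` are chosen without any continuity; along an ultrafilter of times `s ≠ t`
  -- they converge, because the box is compact.
  let F : Ultrafilter ℝ := Ultrafilter.of (𝓝[≠] t)
  have hFne : (F : Filter ℝ) ≤ 𝓝[≠] t := Ultrafilter.of_le _
  have hFt : (F : Filter ℝ) ≤ 𝓝 t := hFne.trans nhdsWithin_le_nhds
  have hbox : IsCompact (Set.univ.pi fun _ : ℕ => Metric.closedBall (0 : h) R) :=
    isCompact_univ_pi fun _ => isCompact_closedBall 0 R
  obtain ⟨u, -, hu⟩ := hbox.ultrafilter_le_nhds (F.map U) (by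
    rw [Filter.le_principal_iff]
    exact Filter.mem_map.2 (Filter.mem_of_superset (hFt hmem) fun s hs => hU s hs))
  have hUu : Filter.Tendsto U F (𝓝 u) := hu
  have hdt : d t = prodExp n u := by
    refine tendsto_nhds_unique (hd.continuousAt.tendsto.mono_left hFt) ?_
    refine (((continuous_prodExp n).tendsto u).comp hUu).congr' ?_
    exact Filter.mem_of_superset (hFt hmem) fun s hs => hdU s hs
  set b := prodExpInv n u with hb
  -- For `v = u` the path is constantly 1; compactness of `[0, 1]` keeps it in `W` for nearby `v`.
  have hnear : ∀ᶠ v in 𝓝 u, ∀ s ∈ Set.Icc (0 : ℝ) 1, prodExp n (u + s • (v - u)) * b ∈ W := by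
    have hcont : Continuous fun q : (ℕ → h) × ℝ => prodExp n (u + q.2 • (q.1 - u)) * b :=
      ((continuous_prodExp n).comp (by fun_prop)).mul continuous_const
    refine isCompact_Icc.eventually_forall_of_forall_eventually fun s _ => ?_
    refine hcont.continuousAt.eventually_mem (x := (u, s)) ?_
    simpa [hb, prodExp_mul_prodExpInv] using hW
  have hexp : ∀ᶠ v in 𝓝 u, NormedSpace.exp (σ (prodExp n v * b) : 𝔸) = prodExp n v * b := by
    filter_upwards [hnear] with v hv
    have := hlog (fun s => prodExp n (u + s • (v - u)) * b) hv
      (by simp [hb, prodExp_mul_prodExpInv]) fun s _ => by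
        obtain ⟨A, hA, hAd⟩ := hh.exists_hasDerivAt_prodExp n u (v - u) s
        exact ⟨A, hA, by simpa [mul_assoc] using hAd.mul_const b⟩
    simpa using this
  let S : Set ℝ := {s | NormedSpace.exp (σ (d s * b) : 𝔸) = d s * b}
  have hS : S ∈ F := by
    filter_upwards [hUu.eventually hexp, hFt hmem] with s hs hs'
    change NormedSpace.exp (σ (d s * b) : 𝔸) = d s * b
    rw [← hdU s hs']
    exact hs
  -- As `d` is differentiable at `t`, its derivative is determined by any set accumulating at `t`.
  -- On `S` the curve `d s * b` is the exponential of a curve in `h` which vanishes at `t`.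
  have hacc : AccPt t (Filter.principal S) :=
    Filter.neBot_of_le (f := (F : Filter ℝ)) (le_inf hFne (Filter.le_principal_iff.2 hS))
  have hd1 : d t * b = 1 := by rw [hdt, hb, prodExp_mul_prodExpInv]
  have hg1 : HasDerivAt (fun s => d s * b) (d' * b) t := hd.mul_const b
  have hg2 : HasDerivAt (fun s => NormedSpace.exp (σ (d s * b) : 𝔸))
      (fderiv ℝ σ 1 (d' * b) : 𝔸) t := by
    have e1 : HasDerivAt (fun s => σ (d s * b)) (fderiv ℝ σ 1 (d' * b)) t := by
      refine HasFDerivAt.comp_hasDerivAt t ?_ hg1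
      rw [hd1]
      exact hσ.hasFDerivAt
    have e2 : HasDerivAt (fun s => (σ (d s * b) : 𝔸)) (fderiv ℝ σ 1 (d' * b) : 𝔸) t :=
      h.subtypeL.hasFDerivAt.comp_hasDerivAt t e1
    have e3 : HasFDerivAt NormedSpace.exp (1 : 𝔸 →L[ℝ] 𝔸) (σ (d t * b) : 𝔸) := by
      rw [hd1, hσ1]
      exact hasFDerivAt_exp_zero (𝕂 := ℝ)
    exact e3.comp_hasDerivAt t e2
  have hg3 : HasDerivWithinAt (fun s => d s * b) (fderiv ℝ σ 1 (d' * b) : 𝔸) S t :=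
    hg2.hasDerivWithinAt.congr (fun s hs => hs.symm) (by simp [hd1, hσ1])
  rw [hdt, ringInverse_prodExp, hacc.uniqueDiffWithinAt.eq_deriv _ hg1.hasDerivWithinAt hg3]
  exact (fderiv ℝ σ 1 (d' * b)).2

/-- A `C¹` curve through the identity consisting of products of exponentials of elements of `h` is
tangent to `h` at the identity. -/
theorem IsExpStable.deriv_zero_mem (hh : IsExpStable h) {d : ℝ → 𝔸} (hd : ContDiffAt ℝ 1 d 0)
    (hd0 : d 0 = 1)
    (hmem : ∀ᶠ s in 𝓝 (0 : ℝ), ∃ n R : ℕ,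
      d s ∈ prodExp n '' Set.univ.pi fun _ => Metric.closedBall (0 : h) R) :
    deriv d 0 ∈ h := by
  have hdiff : ∀ᶠ s in 𝓝 (0 : ℝ), DifferentiableAt ℝ d s :=
    (hd.eventually (by simp)).mono fun z hz => hz.differentiableAt one_ne_zero
  have hcl : IsClosed (h : Set 𝔸) := h.closed_of_finiteDimensional
  have hcont : ContinuousAt (fun s => deriv d s * Ring.inverse (d s)) 0 := by
    refine ContinuousAt.mul ?_ ?_
    · have h1 : ContinuousAt (fun s => fderiv ℝ d s 1) 0 :=
        (hd.fderiv_right (m := 0) (by simp)).continuousAt.clm_apply continuousAt_const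
      simpa using h1
    · refine ContinuousAt.comp (g := Ring.inverse) ?_ hd.continuousAt
      rw [hd0]
      exact NormedRing.inverse_continuousAt 1
  -- Times arbitrarily close to 0 suffice, since `h` is closed and the logarithmic derivative is
  -- continuous at 0.
  have hfreq : ∃ᶠ s in 𝓝 (0 : ℝ), deriv d s * Ring.inverse (d s) ∈ h := by
    rw [Filter.frequently_iff]
    intro V hV
    obtain ⟨δ, hδ, hball⟩ := Metric.mem_nhds_iff.1
      (Filter.inter_mem hV (Filter.inter_mem hdiff hmem))
    have hsub : Metric.closedBall (0 : ℝ) (δ / 2) ⊆ Metric.ball 0 δ :=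
      Metric.closedBall_subset_ball (by linarith)
    let C : ℕ × ℕ → Set ℝ := fun p => Metric.closedBall 0 (δ / 2) ∩
      d ⁻¹' (prodExp p.1 '' Set.univ.pi fun _ => Metric.closedBall (0 : h) p.2)
    -- Adding the complement of the ball makes these countably many closed sets cover all of `ℝ`, as
    -- Baire's theorem requires.
    have hC : ∀ p, IsClosed (C p ∪ (Metric.ball (0 : ℝ) (δ / 2))ᶜ) := fun p => by
      refine IsClosed.union ?_ Metric.isOpen_ball.isClosed_compl
      refine ContinuousOn.preimage_isClosed_of_isClosed (fun s hs => ?_)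
        Metric.isClosed_closedBall ?_
      · have hs' : DifferentiableAt ℝ d s := (hball (hsub hs)).2.1
        exact hs'.continuousAt.continuousWithinAt
      · exact (isCompact_image_prodExp p.1 p.2).isClosed
    have hcover : ⋃ p, (C p ∪ (Metric.ball (0 : ℝ) (δ / 2))ᶜ) = Set.univ := by
      refine Set.eq_univ_of_forall fun s => Set.mem_iUnion.2 ?_
      by_cases hs : s ∈ Metric.ball (0 : ℝ) (δ / 2)
      · obtain ⟨n, R, hnR⟩ := (hball (hsub (Metric.ball_subset_closedBall hs))).2.2
        exact ⟨(n, R), Or.inl ⟨Metric.ball_subset_closedBall hs, hnR⟩⟩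
      · exact ⟨(0, 0), Or.inr hs⟩
    have hdense := dense_iUnion_interior_of_closed hC hcover
    obtain ⟨s, hs, hsU⟩ := hdense.exists_mem_open Metric.isOpen_ball
      (Metric.nonempty_ball.2 (half_pos hδ) : (Metric.ball (0 : ℝ) (δ / 2)).Nonempty)
    obtain ⟨p, hp⟩ := Set.mem_iUnion.1 hs
    obtain ⟨hsV, hsd, -⟩ := hball (hsub (Metric.ball_subset_closedBall hsU))
    refine ⟨s, hsV, hh.deriv_mem (n := p.1) (R := p.2) (DifferentiableAt.hasDerivAt hsd) ?_⟩
    filter_upwards [mem_interior_iff_mem_nhds.1 hp, Metric.isOpen_ball.mem_nhds hsU] with r hr hr'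
    rcases hr with hr | hr
    · exact hr.2
    · exact absurd hr' hr
  have := hcl.mem_of_frequently_of_tendsto hfreq hcont.tendsto
  simpa [hd0] using this

end ExpFoliation

/-! ### Inner automorphisms as products of exponentials -/

namespace LieAut

open ExpFoliation

variable {g : Type*} [LieRing g] [LieAlgebra ℝ g]

theorem coe_ad_mem_adRange (u : g) :
    ((LieDerivation.ad ℝ g u : LieDerivation ℝ g g) : Module.End ℝ g) ∈ adRange g :=
  ⟨u, by ext; simp⟩

theorem exists_eq_ad_of_mem_adRange {Z : Module.End ℝ g} (hZ : Z ∈ adRange g) :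
    ∃ u : g, ((LieDerivation.ad ℝ g u : LieDerivation ℝ g g) : Module.End ℝ g) = Z := by
  obtain ⟨u, rfl⟩ := hZ
  exact ⟨u, by ext; simp⟩

theorem toEnd_mul_toEnd_inv (a : LieAut g) : a.toEnd * a⁻¹.toEnd = 1 := by
  rw [← toEnd_mul, mul_inv_cancel, toEnd_one]

theorem toEnd_inv_mul_toEnd (a : LieAut g) : a⁻¹.toEnd * a.toEnd = 1 := by
  rw [← toEnd_mul, inv_mul_cancel, toEnd_one]

variable [FiniteDimensional ℝ g]

/-- An automorphism `a` satisfies `a ∘ ad v ∘ a⁻¹ = ad (a v)`; here `a = exp (ad u)`. -/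
theorem isExpStable_adRange : IsExpStable (adRange g) := by
  rintro X hX Z hZ
  obtain ⟨u, rfl⟩ := exists_eq_ad_of_mem_adRange hX
  obtain ⟨v, rfl⟩ := exists_eq_ad_of_mem_adRange hZ
  convert coe_ad_mem_adRange (exp (LieDerivation.ad ℝ g u) v) using 1
  ext z
  let a := exp (LieDerivation.ad ℝ g u)
  change a ((LieDerivation.ad ℝ g v : LieDerivation ℝ g g) (a.symm z)) =
    (LieDerivation.ad ℝ g (a v) : LieDerivation ℝ g g) z
  simp only [LieDerivation.ad_apply_apply]
  rw [LieEquiv.map_lie, LieEquiv.apply_symm_apply]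

theorem exists_mem_inner_of_mem_adRange {X : Module.End ℝ g} (hX : X ∈ adRange g) :
    ∃ a ∈ inner g, a.toEnd = NormedSpace.exp X := by
  obtain ⟨u, rfl⟩ := exists_eq_ad_of_mem_adRange hX
  exact ⟨_, Subgroup.subset_closure ⟨u, rfl⟩, rfl⟩

/-- Inverses of generators are again exponentials, of `-ad u`, so products suffice. The bound `R` is
a natural number to keep the family of compact sets countable. -/
theorem exists_prodExp_of_mem_inner {a : LieAut g} (ha : a ∈ inner g) :
    ∃ n R : ℕ, a.toEnd ∈ prodExp n '' Set.univ.pi fun _ =>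
      Metric.closedBall (0 : adRange g) R := by
  have step : ∀ (X : adRange g) (b : LieAut g),
      (∃ n R : ℕ, b.toEnd ∈ prodExp n '' Set.univ.pi fun _ =>
        Metric.closedBall (0 : adRange g) R) →
      ∃ n R : ℕ, NormedSpace.exp (X : Module.End ℝ g) * b.toEnd ∈
        prodExp n '' Set.univ.pi fun _ => Metric.closedBall (0 : adRange g) R := by
    rintro X b ⟨n, R, v, hv, hvb⟩
    obtain ⟨R', hR'⟩ := exists_nat_ge (max (R : ℝ) ‖X‖)
    refine ⟨n + 1, R', fun i => Nat.casesOn i X v, ?_, ?_⟩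
    · rintro (_ | i) -
      · exact mem_closedBall_zero_iff.2 ((le_max_right _ _).trans hR')
      · exact Metric.closedBall_subset_closedBall ((le_max_left _ _).trans hR') (hv i trivial)
    · rw [← hvb]
      rfl
  induction ha using Subgroup.closure_induction_left with
  | one => exact ⟨0, 0, 0, by simp, toEnd_one.symm⟩
  | mul_left x hx y _ ih =>
    obtain ⟨u, rfl⟩ := hx
    exact step ⟨_, coe_ad_mem_adRange u⟩ y ih
  | inv_mul_cancel x hx y _ ih =>
    obtain ⟨u, rfl⟩ := hx
    exact step ⟨_, (adRange g).neg_mem (coe_ad_mem_adRange u)⟩ y ih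

theorem q_eq_iff {a b : LieAut g} : q g a = q g b ↔ a * b⁻¹ ∈ inner g := by
  rw [← mul_inv_eq_one, ← map_inv, ← map_mul]
  exact QuotientGroup.eq_one_iff _

/-! ### Smooth maps from a manifold to the automorphism group -/

section Manifold

variable {E : Type*} [NormedAddCommGroup E] [NormedSpace ℝ E]
  {H : Type*} [TopologicalSpace H] {I : ModelWithCorners ℝ E H}
  {M : Type*} [TopologicalSpace M] [ChartedSpace H M]
  {φ : M → LieAut g}

theorem continuous_deltaTopology_iff (hφ : IsSmooth I φ) :
    @Continuous M (LieAut g) _ (deltaTopology g) φ ↔ IsLocallyConstant (q g ∘ φ) := by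
  have hc : Continuous φ := continuous_induced_rng.2 hφ.continuous
  rw [continuous_inf_rng, and_iff_right hc, continuous_induced_rng]
  let : TopologicalSpace (LieAut g ⧸ inner g) := ⊥
  have : DiscreteTopology (LieAut g ⧸ inner g) := ⟨rfl⟩
  exact (IsLocallyConstant.iff_continuous _).symm

variable [I.Boundaryless]

theorem IsSmooth.dirDeriv_eq_fderiv_chart (hφ : IsSmooth I φ) (x : M) (X : TangentSpace I x) :
    dirDeriv I φ x X =
      fderiv ℝ (fun z => (φ ((extChartAt I x).symm z)).toEnd) (extChartAt I x x) X := by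
  unfold dirDeriv
  rw [((hφ x).mdifferentiableAt (by simp)).mfderiv, I.range_eq_univ, fderivWithin_univ]
  rfl

variable [IsManifold I ∞ M]

theorem IsSmooth.contDiffAt_chart (hφ : IsSmooth I φ) (x : M) {z : E}
    (hz : z ∈ (extChartAt I x).target) :
    ContDiffAt ℝ ∞ (fun z => (φ ((extChartAt I x).symm z)).toEnd) z := by
  have h1 : ContMDiffAt 𝓘(ℝ, E) I ∞ (extChartAt I x).symm z :=
    (contMDiffOn_extChartAt_symm x).contMDiffAt ((isOpen_extChartAt_target x).mem_nhds hz)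
  exact ((hφ _).comp z h1).contDiffAt

/-- Transfers condition 2 to every point of one fixed chart, not only its centre, so that a whole
segment can be followed. -/
theorem IsSmooth.fderiv_chart (hφ : IsSmooth I φ) (x : M) {z : E}
    (hz : z ∈ (extChartAt I x).target) (v : E) :
    ∃ X : TangentSpace I ((extChartAt I x).symm z),
      fderiv ℝ (fun z => (φ ((extChartAt I x).symm z)).toEnd) z v =
        dirDeriv I φ ((extChartAt I x).symm z) X := by
  have h1 : ContMDiffAt 𝓘(ℝ, E) I ∞ (extChartAt I x).symm z :=
    (contMDiffOn_extChartAt_symm x).contMDiffAt ((isOpen_extChartAt_target x).mem_nhds hz)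
  refine ⟨mfderiv 𝓘(ℝ, E) I (extChartAt I x).symm z v, ?_⟩
  rw [← mfderiv_eq_fderiv]
  exact mfderiv_comp_apply z ((hφ _).mdifferentiableAt (by simp)) (h1.mdifferentiableAt (by simp)) v

theorem isLocallyConstant_of_dirDeriv_mem (hφ : IsSmooth I φ)
    (h : ∀ (x : M) (X : TangentSpace I x), dirDeriv I φ x X * (φ x)⁻¹.toEnd ∈ adRange g) :
    IsLocallyConstant (q g ∘ φ) := by
  rw [IsLocallyConstant.iff_eventually_eq]
  intro x
  obtain ⟨σ, -, -, W, hW, hlog⟩ := (isExpStable_adRange (g := g)).exists_log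
  set p := extChartAt I x x with hp
  set f : E → Module.End ℝ g := fun z => (φ ((extChartAt I x).symm z)).toEnd with hf
  set b := (φ x)⁻¹.toEnd with hb
  have hfp : f p * b = 1 := by simp [hf, hp, hb, toEnd_mul_toEnd_inv]
  have hcont : ContinuousAt (fun z => f z * b) p :=
    (hφ.contDiffAt_chart x (mem_extChartAt_target x)).continuousAt.mul continuousAt_const
  have hnhds : ∀ᶠ z in 𝓝 p, z ∈ (extChartAt I x).target ∧ f z * b ∈ W :=
    Filter.Eventually.and (extChartAt_target_mem_nhds x)
      (hcont.eventually_mem (by rwa [hfp]))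
  obtain ⟨δ, hδ, hball⟩ := Metric.eventually_nhds_iff_ball.1 hnhds
  have hy : ∀ᶠ y in 𝓝 x, extChartAt I x y ∈ Metric.ball p δ :=
    (continuousAt_extChartAt x).eventually_mem (Metric.ball_mem_nhds p hδ)
  filter_upwards [hy, extChartAt_source_mem_nhds (I := I) x] with y hy hys
  set v := extChartAt I x y - p with hv
  have hseg : ∀ t ∈ Set.Icc (0 : ℝ) 1, p + t • v ∈ Metric.ball p δ := fun t ht =>
    (convex_ball p δ).add_smul_sub_mem (Metric.mem_ball_self hδ) hy ht
  have hfy : f (p + (1 : ℝ) • v) = (φ y).toEnd := by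
    simp only [hf, hv, one_smul, add_sub_cancel]
    rw [(extChartAt I x).left_inv hys]
  -- Right multiplication by `b` starts the path at 1 and leaves its right logarithmic derivative
  -- unchanged.
  have key := hlog (fun t => f (p + t • v) * b) (fun t ht => (hball _ (hseg t ht)).2)
    (by simpa using hfp) fun t ht => by
      have ht' := (hball _ (hseg t ht)).1
      obtain ⟨X, hX⟩ := hφ.fderiv_chart x ht' v
      refine ⟨_, h _ X, ?_⟩
      rw [← hX, ← mul_assoc]
      have hl : HasDerivAt (fun t : ℝ => p + t • v) v t := by
        simpa using ((hasDerivAt_id t).smul_const v).const_add p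
      have hd : HasDerivAt (fun t : ℝ => f (p + t • v)) (fderiv ℝ f (p + t • v) v) t :=
        HasFDerivAt.comp_hasDerivAt (f := fun t : ℝ => p + t • v) t
          ((hφ.contDiffAt_chart x ht').differentiableAt (by simp)).hasFDerivAt hl
      refine (hd.mul_const b).congr_deriv ?_
      rw [mul_assoc _ _ (f (p + t • v)), toEnd_inv_mul_toEnd, mul_one]
  obtain ⟨c, hc, hcσ⟩ := exists_mem_inner_of_mem_adRange (σ (f (p + (1 : ℝ) • v) * b)).2
  refine q_eq_iff.2 ?_
  convert hc
  apply toEnd_injective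
  rw [hcσ, key, hfy, toEnd_mul]

theorem dirDeriv_mem_of_isLocallyConstant (hφ : IsSmooth I φ)
    (h : IsLocallyConstant (q g ∘ φ)) (x : M) (X : TangentSpace I x) :
    dirDeriv I φ x X * (φ x)⁻¹.toEnd ∈ adRange g := by
  rw [hφ.dirDeriv_eq_fderiv_chart]
  set p := extChartAt I x x with hp
  set f : E → Module.End ℝ g := fun z => (φ ((extChartAt I x).symm z)).toEnd with hf
  set b := (φ x)⁻¹.toEnd with hb
  let v : E := X
  have hfp : ContDiffAt ℝ ∞ f (p + (0 : ℝ) • v) := by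
    rw [zero_smul, add_zero]
    exact hφ.contDiffAt_chart x (mem_extChartAt_target x)
  have hl : ContDiff ℝ ∞ fun t : ℝ => p + t • v := by fun_prop
  have hd : ContDiffAt ℝ ∞ (fun t : ℝ => f (p + t • v) * b) 0 :=
    (hfp.comp (0 : ℝ) hl.contDiffAt).mul contDiffAt_const
  have hderiv : HasDerivAt (fun t : ℝ => f (p + t • v) * b) (fderiv ℝ f p v * b) 0 := by
    have hl' : HasDerivAt (fun t : ℝ => p + t • v) v 0 := by
      simpa using ((hasDerivAt_id (0 : ℝ)).smul_const v).const_add p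
    have h1 := (hfp.differentiableAt (by simp)).hasFDerivAt.comp_hasDerivAt (0 : ℝ) hl'
    rw [zero_smul, add_zero] at h1
    exact h1.mul_const b
  -- Local constancy of `q ∘ φ` puts `φ(y) * φ(x)⁻¹` in `Int(g)` for `y` near `x`.
  have hmem : ∀ᶠ t : ℝ in 𝓝 0, ∃ n R : ℕ, f (p + t • v) * b ∈
      prodExp n '' Set.univ.pi fun _ => Metric.closedBall (0 : adRange g) R := by
    have hsymm : Filter.Tendsto (fun t : ℝ => (extChartAt I x).symm (p + t • v)) (𝓝 0) (𝓝 x) := by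
      have h1 := (continuousAt_extChartAt_symm (I := I) x).tendsto
      rw [extChartAt_to_inv] at h1
      refine h1.comp ?_
      have h2 := hl.continuous.tendsto 0
      rwa [zero_smul, add_zero] at h2
    filter_upwards [hsymm.eventually ((IsLocallyConstant.iff_eventually_eq _).1 h x)] with t ht
    exact exists_prodExp_of_mem_inner (q_eq_iff.1 ht)
  have key := isExpStable_adRange.deriv_zero_mem (hd.of_le (by simp))
    (by simp [hf, hp, hb, toEnd_mul_toEnd_inv]) hmem
  rwa [hderiv.deriv] at key

end Manifold

end LieAut

theorem mainTheorem2
    {g : Type*} [LieRing g] [LieAlgebra ℝ g] [FiniteDimensional ℝ g]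
    {E : Type*} [NormedAddCommGroup E] [NormedSpace ℝ E] [FiniteDimensional ℝ E]
    {H : Type*} [TopologicalSpace H] (I : ModelWithCorners ℝ E H) [I.Boundaryless]
    {M : Type*} [TopologicalSpace M] [ChartedSpace H M] [IsManifold I ∞ M]
    (φ : M → LieAut g) (hφ : LieAut.IsSmooth I φ) :
    (IsLocallyConstant (LieAut.q g ∘ φ) ↔
      ∀ (x : M) (X : TangentSpace I x),
        LieAut.dirDeriv I φ x X * (φ x)⁻¹.toEnd ∈ LieAut.adRange g) ∧
    (IsLocallyConstant (LieAut.q g ∘ φ) ↔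
      @Continuous M (LieAut g) _ (LieAut.deltaTopology g) φ) :=
  ⟨⟨LieAut.dirDeriv_mem_of_isLocallyConstant hφ, LieAut.isLocallyConstant_of_dirDeriv_mem hφ⟩,
    (LieAut.continuous_deltaTopology_iff hφ).symm⟩
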